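/- For a structure $\mathcal{K}$ with universe $K$ and $A\subseteq K$, let $\mathrm{dcl}(A)$ be the set of all $a\in K$ such that $\{a\}$ is definable in $\mathcal{K}$ by a first-order formula with parameters from $A$. Let $\deg^{\exists\text{-synt}}_{\mathrm{rig}}(\mathcal{K})\in\omega\cup\{\infty\}$ be the least $n\in\omega$ such that $K=\mathrm{dcl}(A)$ for some $A\subseteq K$ with $|A|=n$, and $\infty$ if there is no such $n$. Let $\mathcal{M}$ and $\mathcal{N}$ be nonempty structures of relational languages $\Sigma_{\mathcal{M}}$ and $\Sigma_{\mathcal{N}}$, which may have common symbols. The composition $\mathcal{M}[\mathcal{N}]$ is the structure of the language $\Sigma_{\mathcal{M}}\cup\Sigma_{\mathcal{N}}$ with universe $M\times N$ in which an $n$-ary symbol $R$ holds at $((a_1,b_1),\ldots,(a_n,b_n))$ iff $R\in\Sigma_{\mathcal{M}}$ and $(a_1,\ldots,a_n)\in R_{\mathcal{M}}$, or $R\in\Sigma_{\mathcal{N}}$, $a_1=\ldots=a_n$ and $(b_1,\ldots,b_n)\in R_{\mathcal{N}}$. It is called $E$-definable if it has an $\emptyset$-definable equivalence relation $E$ whose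 classes are exactly the sets $\{a\}\times N$, $a\in M$, and these classes are copies of $\mathcal{N}$, i.e. for every $a\in M$ the map $b\mapsto(a,b)$ preserves and reflects all relations of $\Sigma_{\mathcal{N}}$. Theorem. Let $\mathcal{M}[\mathcal{N}]$ be an $E$-definable composition. (1) Suppose that $N=\mathrm{dcl}(\emptyset)$ in $\mathcal{N}$, and that each symbol $R\in\Sigma_{\mathcal{M}}\cap\Sigma_{\mathcal{N}}$ (if there are any) holds in $\mathcal{M}$ at all constant tuples $(a,\ldots,a)$, $a\in M$, or at none of them. Then $$\deg^{\exists\text{-synt}}_{\mathrm{rig}}(\mathcal{M}[\mathcal{N}])=\deg^{\exists\text{-synt}}_{\mathrm{rig}}(\mathcal{M}).$$ In particular, $\deg^{\exists\text{-synt}}_{\mathrm{rig}}(\mathcal{M}[\mathcal{N}])$ is finite iff $\deg^{\exists\text{-synt}}_{\mathrm{rig}}(\mathcal{M})$ is finite. (2) If $N\neq\mathrm{dcl}(\emptyset)$ in $\mathcal{N}$, then $$\deg^{\exists\text{-synt}}_{\mathrm{rig}}(\mathcal{M}[\mathcal{N}])=|M|\cdot\deg^{\exists\text{-synt}}_{\mathrm{rig}}(\mathcal{N}),$$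 where $|M|=\infty$ if $M$ is infinite. In particular, $\deg^{\exists\text{-synt}}_{\mathrm{rig}}(\mathcal{M}[\mathcal{N}])$ is finite iff $\deg^{\exists\text{-synt}}_{\mathrm{rig}}(\mathcal{N})$ and $M$ are finite. -/

import Mathlib

open Set

universe u v w

namespace Rigidity

/-- The definable closure of `A`: the elements `a` such that `{a}` is the solution set of a
first-order formula with parameters from `A`. -/
def dcl (L : FirstOrder.Language.{u, v}) {M : Type w} [L.Structure M] (A : Set M) : Set M :=
  {a | A.Definable₁ L {a}}

/-- Syntactic `A`-rigidity: the whole universe is the definable closure of `A`. -/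
def SyntRigidOver (L : FirstOrder.Language.{u, v}) {M : Type w} [L.Structure M] (A : Set M) : Prop :=
  dcl L A = univ

/-- `∃`-syntactic `n`-rigidity: syntactic `A`-rigidity for some `A` with exactly `n` elements. -/
def ExistsSyntRigid (L : FirstOrder.Language.{u, v}) (M : Type w) [L.Structure M] (n : ℕ) : Prop :=
  ∃ A : Set M, A.encard = n ∧ SyntRigidOver L A

/-- The `∃`-syntactic degree of rigidity: the least natural number `n` such that the structure is
`∃`-syntactically `n`-rigid, and `⊤` if there is no such `n`. -/
noncomputable def degExistsSynt (L : FirstOrder.Language.{u, v}) (M : Type w) [L.Structure M] : ℕ∞ :=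
  sInf {k : ℕ∞ | ∃ n : ℕ, k = n ∧ ExistsSyntRigid L M n}

/-- The relational language whose `n`-ary symbols are the elements of `Sg n`. Languages which may
share symbols are given as subfamilies of one family `S` of symbols, graded by arity. -/
def relLang {S : ℕ → Type u} (Sg : ∀ n, Set (S n)) : FirstOrder.Language.{0, u} :=
  ⟨fun _ => Empty, fun n => Sg n⟩

/-- The symbols of the union of two relational languages. -/
def unionSymb {S : ℕ → Type u} (SM SN : ∀ n, Set (S n)) : ∀ n, Set (S n) :=
  fun n => SM n ∪ SN n

section Composition

variable {S : ℕ → Type u} (SM SN : ∀ n, Set (S n)) (M : Type v) (N : Type w)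
  [(relLang SM).Structure M] [(relLang SN).Structure N]

/-- The interpretation of the symbol `R : S n` of the language `Sg` in `X`, and the empty relation
if `R` does not belong to `Sg`. -/
def rel {S : ℕ → Type u} (Sg : ∀ n, Set (S n)) {X : Type v} [(relLang Sg).Structure X]
    {n : ℕ} (R : S n) (x : Fin n → X) : Prop :=
  ∃ h : R ∈ Sg n,
    FirstOrder.Language.Structure.RelMap (L := relLang Sg) (M := X) (n := n) ⟨R, h⟩ x

/-- The composition `M[N]`, on the universe `M × N`. A symbol `R` holds at
`((a₁, b₁), …, (aₙ, bₙ))` iff `R` is a symbol of `M` and holds at `(a₁, …, aₙ)`, or `R` is a symbol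
of `N`, `a₁ = … = aₙ` and `R` holds at `(b₁, …, bₙ)`. -/
instance compStructure : (relLang (unionSymb SM SN)).Structure (M × N) where
  funMap := fun f => Empty.elim f
  RelMap := fun R x =>
    rel SM R.1 (fun i => (x i).1) ∨
      ((∀ i j, (x i).1 = (x j).1) ∧ rel SN R.1 (fun i => (x i).2))

/-- The composition `M[N]` is `E`-definable: it has an `∅`-definable equivalence relation whose
classes are the sets `{a} × N`, and these carry copies of `N`, that is, for each `a` the bijection
`b ↦ (a, b)` from `N` onto `{a} × N` preserves and reflects all relations of the language
of `N`. -/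
def IsEDefinableComposition : Prop :=
  (∃ E : Setoid (M × N),
    (∅ : Set (M × N)).Definable₂ (relLang (unionSymb SM SN)) {p | E p.1 p.2} ∧
    E.classes = range fun a : M => {p : M × N | p.1 = a}) ∧
  ∀ (a : M) (n : ℕ) (R : S n), R ∈ SN n → ∀ b : Fin n → N,
    (rel (unionSymb SM SN) R (fun i => (a, b i)) ↔ rel SN R b)

/-- Every symbol common to both languages holds in `M` either at all constant tuples
`(a, …, a)` or at none of them. -/
def SharedSymbolsDiagonal : Prop :=
  ∀ (n : ℕ) (R : S n), R ∈ SM n → R ∈ SN n →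
    (∀ a : M, rel SM R (fun _ : Fin n => a)) ∨ (∀ a : M, ¬ rel SM R (fun _ : Fin n => a))

end Composition

end Rigidity

/-!
For the upper bounds, each block `{a} × N` interprets `N` by the second projection, so a point
definable in `N` over the trace of `A` on the block is definable in `M[N]` as soon as the block is.
The blocks are definable because `M` is interpreted in `M[N]` by the first projection: a relation of
`M` is recovered from the corresponding relation of `M[N]` by adding or removing all tuples lying in
one block, and this is where the hypothesis on the shared symbols enters.

For the lower bounds, the maps `a ↦ (a, b)` for varying `b` cover `M[N]`, and so do, for fixed `a`,
the map `b ↦ (a, b)` and the constant maps with values outside the block. Pulling a formula of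
`M[N]` back along such a cover gives a family of relations which is finite up to equality, whence
quantification over the index of the covering map amounts to a finite disjunction. Therefore
`dcl A` projects into the `dcl` of the projection of `A`, and meets each block within the `dcl` of
the trace of `A` on that block.
-/

namespace Rigidity

open FirstOrder FirstOrder.Language

section Definability

variable {L : FirstOrder.Language.{u, v}} {K : Type w} [L.Structure K] {A : Set K} {γ : Type*}

theorem definable_relMap {n : ℕ} (R : L.Relations n) :
    A.Definable L {x : Fin n → K | Structure.RelMap R x} :=
  (empty_definable_iff.2 ⟨R.formula Term.var, by ext x; simp⟩).mono (empty_subset A)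

theorem definable_forall_rel [Finite γ] {r : Set (K × K)} (hr : A.Definable₂ L r) :
    A.Definable L {x : γ → K | ∀ i j, (x i, x j) ∈ r} := by
  simp only [ofPred_forall]
  exact definable_iInter_of_finite fun i => definable_iInter_of_finite fun j =>
    hr.preimage_comp ![i, j]

theorem definable_exists {s : Set (Option γ → K)} (hs : A.Definable L s) :
    A.Definable L {x : γ → K | ∃ y, Option.elim' y x ∈ s} := by
  let toSum : Option γ → γ ⊕ Unit := Option.elim' (Sum.inr ()) Sum.inl
  have elim'_eq : ∀ (x : γ → K) (u : Unit → K),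
      Sum.elim x u ∘ toSum = Option.elim' (u ()) x := by
    intro x u
    funext i
    cases i <;> rfl
  convert (hs.preimage_comp toSum).exists_of_finite using 1
  ext x
  simp only [mem_ofPred_eq, mem_preimage, elim'_eq]
  exact ⟨fun ⟨y, hy⟩ => ⟨fun _ => y, hy⟩, fun ⟨u, hu⟩ => ⟨u (), hu⟩⟩

theorem definable₁_elim' {s : Set (Option γ → K)} (hs : A.Definable L s) (c : γ → A) :
    A.Definable₁ L {y | Option.elim' y (fun i => (c i : K)) ∈ s} := by
  obtain ⟨φ, rfl⟩ := definable_iff_exists_formula_sum.1 hs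
  refine definable_iff_exists_formula_sum.2
    ⟨φ.relabel (Sum.elim Sum.inl (Option.elim' (Sum.inr 0) fun i => Sum.inl (c i))), ?_⟩
  ext y
  simp only [mem_ofPred_eq, Formula.realize_relabel]
  refine iff_of_eq (congrArg _ (funext fun i => ?_))
  rcases i with a | _ | i <;> rfl

theorem definable₁_iff_exists_empty_definable {t : Set K} :
    A.Definable₁ L t ↔ ∃ s : Set (Option A → K), (∅ : Set K).Definable L s ∧
      ∀ y, Option.elim' y Subtype.val ∈ s ↔ y ∈ t := by
  constructor
  · intro ht
    obtain ⟨φ, hφ⟩ := definable_iff_exists_formula_sum.1 ht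
    let toOption : A ⊕ Fin 1 → Option A := Sum.elim some fun _ => none
    refine ⟨_, empty_definable_iff.2 ⟨φ.relabel toOption, rfl⟩, fun y => ?_⟩
    have elim'_toOption :
        Option.elim' y Subtype.val ∘ toOption = Sum.elim Subtype.val fun _ => y := by
      funext i
      cases i <;> rfl
    rw [mem_ofPred_eq, Formula.realize_relabel, elim'_toOption]
    exact (Set.ext_iff.1 hφ fun _ => y).symm
  · rintro ⟨s, hs, h⟩
    convert definable₁_elim' (hs.mono (empty_subset A)) id using 1
    exact Set.ext fun y => (h y).symm

theorem definable₁_section {r : Set (K × K)} (hr : A.Definable₂ L r) {c : K} (hc : c ∈ A) :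
    A.Definable₁ L {y | (y, c) ∈ r} :=
  definable₁_elim' (hr.preimage_comp ![none, some ()]) fun _ => ⟨c, hc⟩

end Definability

section Induction

universe x

variable {L : FirstOrder.Language.{u, v}} [L.IsRelational] {K : Type w} [L.Structure K]

theorem exists_term_eq_var {γ : Type*} (t : L.Term γ) : ∃ i, t = Term.var i := by
  cases t with
  | var i => exact ⟨i, rfl⟩
  | func f _ => exact isEmptyElim f

theorem empty_definable_induction {P : ∀ {γ : Type x}, Set (γ → K) → Prop}
    (empty : ∀ {γ}, P (∅ : Set (γ → K)))
    (eq : ∀ {γ} (i j : γ), P {x : γ → K | x i = x j})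
    (relMap : ∀ {γ} {n : ℕ} (R : L.Relations n) (t : Fin n → γ),
      P {x : γ → K | Structure.RelMap R (x ∘ t)})
    (compl : ∀ {γ} {s : Set (γ → K)}, P s → P sᶜ)
    (union : ∀ {γ} {s t : Set (γ → K)}, P s → P t → P (s ∪ t))
    (preimage_comp : ∀ {γ δ} (g : γ → δ) {s : Set (γ → K)}, P s →
      P ((fun x : δ → K => x ∘ g) ⁻¹' s))
    (exists_elim' : ∀ {γ} {s : Set (Option γ → K)}, P s →
      P {x : γ → K | ∃ y, Option.elim' y x ∈ s})
    {γ : Type x} {s : Set (γ → K)} (hs : (∅ : Set K).Definable L s) : P s := by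
  have realize {n : ℕ} (φ : L.BoundedFormula γ n) :
      P {x : γ ⊕ Fin n → K | φ.Realize (x ∘ Sum.inl) (x ∘ Sum.inr)} := by
    induction φ with
    | falsum => exact empty
    | equal t₁ t₂ =>
      obtain ⟨i, rfl⟩ := exists_term_eq_var t₁
      obtain ⟨j, rfl⟩ := exists_term_eq_var t₂
      simpa only [BoundedFormula.Realize, Sum.elim_comp_inl_inr] using! eq i j
    | rel R ts =>
      choose t ht using fun i => exists_term_eq_var (ts i)
      simpa only [BoundedFormula.Realize, Sum.elim_comp_inl_inr, ht] using! relMap R t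
    | imp φ ψ ihφ ihψ =>
      convert union (compl ihφ) ihψ using 1
      ext x
      exact imp_iff_not_or
    | @all n φ ih =>
      let e : γ ⊕ Fin (n + 1) → Option (γ ⊕ Fin n) :=
        Sum.elim (some ∘ Sum.inl) (Fin.snoc (some ∘ Sum.inr) none)
      have elim'_inr (x : γ ⊕ Fin n → K) (y : K) :
          Option.elim' y x ∘ e ∘ Sum.inr = Fin.snoc (x ∘ Sum.inr) y := by
        simp only [e, Sum.elim_comp_inr, Fin.comp_snoc]
        rfl
      convert compl (exists_elim' (preimage_comp e (compl ih))) using 1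
      ext x
      simp only [BoundedFormula.realize_all, mem_ofPred_eq, mem_compl_iff, mem_preimage, not_exists,
        not_not, Function.comp_assoc, elim'_inr]
      rfl
  obtain ⟨φ, rfl⟩ := empty_definable_iff.1 hs
  convert preimage_comp (Sum.elim id Fin.elim0 : γ ⊕ Fin 0 → γ) (realize φ) using 1
  ext x
  exact iff_of_eq (congrArg₂ (BoundedFormula.Realize φ) rfl (Subsingleton.elim _ _))

end Induction

section Interpretation

variable {L : FirstOrder.Language.{u, v}} {K : Type w} [L.Structure K] {A D : Set K}
  {γ : Type*}

variable (L) in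
/-- The relation `s` coincides with an `A`-definable one on tuples from `D`. The definable relation
is not required to be contained in `D`, as `D ^ γ` need not be definable for infinite `γ`. -/
def DefinableOn (A D : Set K) (s : Set (γ → K)) : Prop :=
  ∃ s' : Set (γ → K), A.Definable L s' ∧ ∀ x, (∀ i, x i ∈ D) → (x ∈ s' ↔ x ∈ s)

theorem DefinableOn.of_definable {s : Set (γ → K)} (hs : A.Definable L s) : DefinableOn L A D s :=
  ⟨s, hs, fun _ _ => Iff.rfl⟩

theorem DefinableOn.compl {s : Set (γ → K)} (hs : DefinableOn L A D s) : DefinableOn L A D sᶜ := by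
  obtain ⟨s', hs', h⟩ := hs
  exact ⟨s'ᶜ, hs'.compl, fun x hx => not_congr (h x hx)⟩

theorem DefinableOn.union {s t : Set (γ → K)} (hs : DefinableOn L A D s)
    (ht : DefinableOn L A D t) : DefinableOn L A D (s ∪ t) := by
  obtain ⟨s', hs', hs⟩ := hs
  obtain ⟨t', ht', ht⟩ := ht
  exact ⟨s' ∪ t', hs'.union ht', fun x hx => or_congr (hs x hx) (ht x hx)⟩

theorem DefinableOn.preimage_comp {δ : Type*} {s : Set (γ → K)} (hs : DefinableOn L A D s)
    (g : γ → δ) : DefinableOn L A D ((fun x : δ → K => x ∘ g) ⁻¹' s) := by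
  obtain ⟨s', hs', h⟩ := hs
  exact ⟨_, hs'.preimage_comp g, fun x hx => h (x ∘ g) fun i => hx (g i)⟩

theorem DefinableOn.exists_mem {s : Set (Option γ → K)} (hD : A.Definable₁ L D)
    (hs : DefinableOn L A D s) :
    DefinableOn L A D {x : γ → K | ∃ y ∈ D, Option.elim' y x ∈ s} := by
  obtain ⟨s', hs', h⟩ := hs
  refine ⟨_, definable_exists ((hD.preimage_comp fun _ => none).inter hs'), fun x hx => ?_⟩
  exact exists_congr fun y => and_congr_right fun hy =>
    h (Option.elim' y x) (Option.forall.2 ⟨hy, hx⟩)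

/-- The map `f`, restricted to the `A`-definable set `D`, interprets the structure `K'` in `K`: it
maps `D` onto `K'`, and equality and the relations of `K'` pull back to relations definable on `D`
with parameters from `A`. -/
structure IsInterpretation (L : FirstOrder.Language.{u, v}) (L' : FirstOrder.Language)
    {K K' : Type*} [L.Structure K] [L'.Structure K'] (A D : Set K) (f : K → K') : Prop where
  definable_domain : A.Definable₁ L D
  surjOn : SurjOn f D univ
  definableOn_eq : DefinableOn L A D {x : Fin 2 → K | f (x 0) = f (x 1)}
  definableOn_relMap : ∀ {n : ℕ} (R : L'.Relations n),
    DefinableOn L A D {x : Fin n → K | Structure.RelMap R (f ∘ x)}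

namespace IsInterpretation

variable {L' : FirstOrder.Language} [L'.IsRelational] {K' : Type*} [L'.Structure K'] {f : K → K'}

theorem definableOn_preimage (hf : IsInterpretation L L' A D f) {t : Set (γ → K')}
    (ht : (∅ : Set K').Definable L' t) : DefinableOn L A D {x : γ → K | f ∘ x ∈ t} := by
  refine empty_definable_induction
    (P := fun {γ} (t : Set (γ → K')) => DefinableOn L A D {x : γ → K | f ∘ x ∈ t})
    (DefinableOn.of_definable definable_empty) (fun i j => hf.definableOn_eq.preimage_comp ![i, j])
    (fun R g => (hf.definableOn_relMap R).preimage_comp g) DefinableOn.compl DefinableOn.union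
    (fun g _ hs => hs.preimage_comp g) (fun {γ s} hs => ?_) ht
  have elim'_comp (x : γ → K) (y : K) : f ∘ Option.elim' y x = Option.elim' (f y) (f ∘ x) := by
    funext i
    cases i <;> rfl
  convert hs.exists_mem hf.definable_domain using 1
  ext x
  simp only [mem_ofPred_eq, elim'_comp]
  constructor
  · rintro ⟨y', hy'⟩
    obtain ⟨y, hyD, rfl⟩ := hf.surjOn (mem_univ y')
    exact ⟨y, hyD, hy'⟩
  · rintro ⟨y, -, hy⟩
    exact ⟨f y, hy⟩

theorem definable₁_inter_preimage (hf : IsInterpretation L L' A D f) {B t : Set K'}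
    (hB : B ⊆ f '' (A ∩ D)) (ht : B.Definable₁ L' t) : A.Definable₁ L (D ∩ f ⁻¹' t) := by
  obtain ⟨s, hs, hst⟩ := definable₁_iff_exists_empty_definable.1 ht
  obtain ⟨s', hs', h⟩ := hf.definableOn_preimage hs
  choose c hc hfc using fun b : B => hB b.2
  have inter_eq : D ∩ f ⁻¹' t = D ∩ {x | Option.elim' x c ∈ s'} := by
    ext x
    refine and_congr_right fun hx => ?_
    have comp_elim' : f ∘ Option.elim' x c = Option.elim' (f x) Subtype.val := by
      funext i
      cases i with
      | none => rfl
      | some b => exact hfc b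
    rw [mem_preimage, ← hst, ← comp_elim']
    exact (h _ (Option.forall.2 ⟨hx, fun b => (hc b).2⟩)).symm
  rw [inter_eq]
  exact hf.definable_domain.inter (definable₁_elim' hs' fun b => ⟨c b, (hc b).1⟩)

end IsInterpretation

end Interpretation

section FiniteFamily

variable {L : FirstOrder.Language.{u, v}} {K : Type w} [L.Structure K] {ι γ : Type*}

variable (L) in
/-- The family `F` consists of `∅`-definable relations, only finitely many of them distinct. Unlike
mere definability of the members, this passes to the unions `⋃ i ∈ I, F i`, `I` infinite, which
arise from quantification over the index. -/
def FinitelyDefinable (F : ι → Set (γ → K)) : Prop :=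
  (range F).Finite ∧ ∀ i, (∅ : Set K).Definable L (F i)

namespace FinitelyDefinable

theorem of_forall_mem {F : ι → Set (γ → K)} {G : Set (Set (γ → K))} (hG : G.Finite)
    (hdef : ∀ s ∈ G, (∅ : Set K).Definable L s) (hF : ∀ i, F i ∈ G) : FinitelyDefinable L F :=
  ⟨hG.subset (range_subset_iff.2 hF), fun i => hdef _ (hF i)⟩

theorem map {δ : Type*} {F : ι → Set (γ → K)} (hF : FinitelyDefinable L F)
    (op : Set (γ → K) → Set (δ → K))
    (hop : ∀ {s}, (∅ : Set K).Definable L s → (∅ : Set K).Definable L (op s)) :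
    FinitelyDefinable L fun i => op (F i) :=
  .of_forall_mem (hF.1.image op) (by rintro _ ⟨_, ⟨i, rfl⟩, rfl⟩; exact hop (hF.2 i))
    fun i => mem_image_of_mem op (mem_range_self i)

theorem union {F G : ι → Set (γ → K)} (hF : FinitelyDefinable L F) (hG : FinitelyDefinable L G) :
    FinitelyDefinable L fun i => F i ∪ G i :=
  ⟨(hF.1.image2 (· ∪ ·) hG.1).subset (range_subset_iff.2 fun i =>
      mem_image2_of_mem (mem_range_self i) (mem_range_self i)),
    fun i => (hF.2 i).union (hG.2 i)⟩

theorem comp {κ : Type*} {F : ι → Set (γ → K)} (hF : FinitelyDefinable L F) (e : κ → ι) :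
    FinitelyDefinable L fun k => F (e k) :=
  ⟨hF.1.subset (range_comp_subset_range e F), fun k => hF.2 (e k)⟩

theorem iUnion {κ Θ : Type*} {F : ι → Set (γ → K)} (hF : FinitelyDefinable L F) (e : κ → Θ → ι) :
    FinitelyDefinable L fun k => ⋃ θ, F (e k θ) := by
  refine .of_forall_mem (G := sUnion '' {G | G ⊆ range F}) (hF.1.finite_subsets.image _) ?_
    fun k => ⟨range fun θ => F (e k θ), range_subset_iff.2 fun θ => mem_range_self _,
      sUnion_range _⟩
  rintro _ ⟨G, hG, rfl⟩
  have : Finite G := hF.1.subset hG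
  rw [sUnion_eq_iUnion]
  refine definable_iUnion_of_finite fun s => ?_
  obtain ⟨i, hi⟩ := hG s.2
  exact hi ▸ hF.2 i

end FinitelyDefinable

end FiniteFamily

section Cover

variable {L L' : FirstOrder.Language} {K K' Θ : Type*} [L.Structure K] [L'.Structure K']

variable (L L') in
/-- The maps `T θ : K' → K` jointly cover `K`, and equality and the relations of `K` pull back along
them to families of relations of `K'` which are finitely definable. -/
structure IsDefinableCover (T : Θ → K' → K) : Prop where
  exists_eq : ∀ x, ∃ θ y, T θ y = x
  finitelyDefinable_eq : FinitelyDefinable L' fun θ : Fin 2 → Θ =>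
    {y : Fin 2 → K' | T (θ 0) (y 0) = T (θ 1) (y 1)}
  finitelyDefinable_relMap : ∀ {n : ℕ} (R : L.Relations n),
    FinitelyDefinable L' fun θ : Fin n → Θ =>
      {y : Fin n → K' | Structure.RelMap R fun i => T (θ i) (y i)}

namespace IsDefinableCover

variable [L.IsRelational] {T : Θ → K' → K}

theorem finitelyDefinable_preimage (hT : IsDefinableCover L L' T) {γ : Type*} {s : Set (γ → K)}
    (hs : (∅ : Set K).Definable L s) :
    FinitelyDefinable L' fun θ : γ → Θ => {y : γ → K' | (fun i => T (θ i) (y i)) ∈ s} := by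
  refine empty_definable_induction
    (P := fun {γ} (s : Set (γ → K)) =>
      FinitelyDefinable L' fun θ : γ → Θ => {y : γ → K' | (fun i => T (θ i) (y i)) ∈ s})
    ?_ (fun i j => ?_) (fun R g => ?_) (fun hs => hs.map _ Definable.compl)
    (fun hs ht => hs.union ht) (fun g s hs => ?_) (fun {γ s} hs => ?_) hs
  · exact .of_forall_mem (finite_singleton ∅) (by simp [definable_empty]) fun _ => rfl
  · exact (hT.finitelyDefinable_eq.comp (· ∘ ![i, j])).map _ (Definable.preimage_comp ![i, j])
  · exact ((hT.finitelyDefinable_relMap R).comp (· ∘ g)).map _ (Definable.preimage_comp g)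
  · exact (hs.comp (· ∘ g)).map _ (Definable.preimage_comp g)
  · convert (hs.map _ definable_exists).iUnion fun (θ : γ → Θ) θ' => Option.elim' θ' θ
      using 2 with θ
    have elim'_eq (y : γ → K') (θ' : Θ) (y' : K') :
        (fun i => T (Option.elim' θ' θ i) (Option.elim' y' y i)) =
          Option.elim' (T θ' y') fun i => T (θ i) (y i) := by
      funext i
      cases i <;> rfl
    ext y
    simp only [mem_ofPred_eq, mem_iUnion, elim'_eq]
    constructor
    · rintro ⟨x, hx⟩
      obtain ⟨θ', y', rfl⟩ := hT.exists_eq x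
      exact ⟨θ', y', hx⟩
    · rintro ⟨θ', y', h⟩
      exact ⟨T θ' y', h⟩

theorem definable₁_preimage (hT : IsDefinableCover L L' T) {A : Set K} {B : Set K'}
    (hA : ∀ p ∈ A, ∃ θ, p ∈ T θ '' B ∨ ∀ y, T θ y = p) {s : Set K} (hs : A.Definable₁ L s) (θ : Θ) :
    B.Definable₁ L' (T θ ⁻¹' s) := by
  have exists_parameter (p : A) :
      ∃ θ, ∃ o : Option B, ∀ y, T θ (Option.elim' y Subtype.val o) = p := by
    obtain ⟨θ, ⟨b, hb, hp⟩ | hp⟩ := hA p p.2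
    · exact ⟨θ, some ⟨b, hb⟩, fun _ => hp⟩
    · exact ⟨θ, none, hp⟩
  choose η o ho using exists_parameter
  obtain ⟨s', hs', h⟩ := definable₁_iff_exists_empty_definable.1 hs
  refine definable₁_iff_exists_empty_definable.2
    ⟨_, ((hT.finitelyDefinable_preimage hs').2 (Option.elim' θ η)).preimage_comp
      (Option.elim' none o), fun y => ?_⟩
  rw [mem_preimage, mem_preimage, ← h, mem_ofPred_eq]
  refine iff_of_eq (congrArg (· ∈ s') (funext fun i => ?_))
  cases i with
  | none => rfl
  | some p => exact ho p y

end IsDefinableCover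

end Cover

section Degree

variable {L : FirstOrder.Language.{u, v}} {M : Type w} [L.Structure M]

theorem SyntRigidOver.mem_dcl {A : Set M} (hA : SyntRigidOver L A) (a : M) : a ∈ dcl L A :=
  eq_univ_iff_forall.1 hA a

theorem degExistsSynt_le_encard {A : Set M} (hA : SyntRigidOver L A) :
    degExistsSynt L M ≤ A.encard := by
  rcases A.finite_or_infinite with hfin | hinf
  · exact sInf_le ⟨A.ncard, hfin.cast_ncard_eq.symm, A, hfin.cast_ncard_eq.symm, hA⟩
  · exact hinf.encard_eq ▸ le_top

theorem le_degExistsSynt {c : ℕ∞} (h : ∀ A : Set M, SyntRigidOver L A → c ≤ A.encard) :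
    c ≤ degExistsSynt L M := by
  refine le_sInf ?_
  rintro _ ⟨n, rfl, A, hn, hA⟩
  exact hn ▸ h A hA

theorem exists_encard_eq_degExistsSynt (h : degExistsSynt L M ≠ ⊤) :
    ∃ A : Set M, A.encard = degExistsSynt L M ∧ SyntRigidOver L A := by
  have hne : {k : ℕ∞ | ∃ n : ℕ, k = n ∧ ExistsSyntRigid L M n}.Nonempty :=
    nonempty_iff_ne_empty.2 fun hempty => h (by rw [degExistsSynt, hempty, sInf_empty])
  obtain ⟨n, hn, A, hA, hrigid⟩ := csInf_mem hne
  exact ⟨A, hA.trans hn.symm, hrigid⟩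

theorem degExistsSynt_ne_zero (h : ¬ SyntRigidOver L (∅ : Set M)) : degExistsSynt L M ≠ 0 := by
  intro h0
  obtain ⟨A, hA, hrigid⟩ := exists_encard_eq_degExistsSynt (L := L) (M := M) (by simp [h0])
  rw [h0, encard_eq_zero] at hA
  exact h (hA ▸ hrigid)

end Degree

theorem card_mul_le_encard {M N : Type*} {A : Set (M × N)} {c : ℕ∞}
    (h : ∀ a, c ≤ (Prod.mk a ⁻¹' A).encard) : ENat.card M * c ≤ A.encard := by
  rcases eq_or_ne c 0 with rfl | hc
  · simp
  rcases A.finite_or_infinite with hfin | hinf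
  · have image_fst : Prod.fst '' A = univ := eq_univ_of_forall fun a => by
      obtain ⟨b, hb⟩ := encard_ne_zero.1 (ne_bot_of_le_ne_bot hc (h a))
      exact ⟨(a, b), hb, rfl⟩
    have : Finite M := finite_univ_iff.1 (image_fst ▸ hfin.image _)
    have := Fintype.ofFinite M
    have iUnion_fiber : A = ⋃ a, Prod.mk a '' (Prod.mk a ⁻¹' A) := by ext ⟨a, b⟩; simp
    have disjoint_fiber : Pairwise fun a a' =>
        Disjoint (Prod.mk a '' (Prod.mk a ⁻¹' A)) (Prod.mk a' '' (Prod.mk a' ⁻¹' A)) := by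
      intro a a' ne
      refine disjoint_left.2 ?_
      rintro _ ⟨b, -, rfl⟩ ⟨b', -, h⟩
      exact ne (congrArg Prod.fst h).symm
    calc ENat.card M * c = ∑ _ : M, c := by simp
      _ ≤ ∑ a, (Prod.mk a '' (Prod.mk a ⁻¹' A)).encard :=
        Finset.sum_le_sum fun a _ =>
          (h a).trans_eq ((Prod.mk_right_injective a).encard_image _).symm
      _ = A.encard := by
        rw [← finsum_eq_sum_of_fintype, ← encard_iUnion_of_finite disjoint_fiber, ← iUnion_fiber]
  · exact hinf.encard_eq ▸ le_top

theorem exists_eq_const {ι X : Type*} [Nonempty X] {x : ι → X} (h : ∀ i j, x i = x j) :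
    ∃ a, x = fun _ => a := by
  rcases isEmpty_or_nonempty ι with _ | ⟨⟨i⟩⟩
  · exact ⟨Classical.arbitrary X, Subsingleton.elim _ _⟩
  · exact ⟨x i, funext fun j => h j i⟩

section RelationalLanguages

variable {S : ℕ → Type u} {Sg : ∀ n, Set (S n)}

instance : (relLang Sg).IsRelational := fun _ => inferInstanceAs (IsEmpty Empty)

variable {X : Type w} [(relLang Sg).Structure X] {n : ℕ}

theorem relMap_iff_rel (R : (relLang Sg).Relations n) (x : Fin n → X) :
    Structure.RelMap R x ↔ rel Sg R.1 x :=
  ⟨fun h => ⟨R.2, h⟩, fun ⟨_, h⟩ => h⟩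

theorem definable_rel {A : Set X} (R : S n) :
    A.Definable (relLang Sg) {x : Fin n → X | rel Sg R x} := by
  by_cases hR : R ∈ Sg n
  · convert definable_relMap (L := relLang Sg) (K := X) (n := n) ⟨R, hR⟩ using 3 with x
    exact (relMap_iff_rel (Sg := Sg) ⟨R, hR⟩ x).symm
  · simp [rel, hR]

end RelationalLanguages

section Composition

variable {S : ℕ → Type u} {SM SN : ∀ n, Set (S n)} {M : Type v} {N : Type w}
  [(relLang SM).Structure M] [(relLang SN).Structure N]

theorem rel_unionSymb_iff {n : ℕ} {R : S n} {x : Fin n → M × N} :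
    rel (unionSymb SM SN) R x ↔ rel SM R (fun i => (x i).1) ∨
      ((∀ i j, (x i).1 = (x j).1) ∧ rel SN R (fun i => (x i).2)) :=
  ⟨fun ⟨_, h⟩ => h, fun h => ⟨h.imp (·.1) (·.2.1), h⟩⟩

theorem isDefinableCover_prodMk_left :
    IsDefinableCover (relLang (unionSymb SM SN)) (relLang SM) fun (b : N) (a : M) => (a, b) where
  exists_eq := fun x => ⟨x.2, x.1, rfl⟩
  finitelyDefinable_eq := by
    refine .of_forall_mem (G := {{y | y 0 = y 1}, ∅}) (toFinite _) ?_ fun θ => ?_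
    · rintro _ (rfl | rfl)
      exacts [Definable.diagonal _ _, definable_empty]
    · by_cases hθ : θ 0 = θ 1 <;> simp [hθ]
  finitelyDefinable_relMap := fun {n} R => by
    refine .of_forall_mem (G := {{y | rel SM R.1 y},
      {y | rel SM R.1 y} ∪ {y | ∀ i j, (y i, y j) ∈ diagonal M}}) (toFinite _) ?_ fun θ => ?_
    · rintro _ (rfl | rfl)
      exacts [definable_rel _,
        (definable_rel _).union (definable_forall_rel (Definable.diagonal _ _))]
    · simp only [relMap_iff_rel, rel_unionSymb_iff]
      by_cases hθ : rel SN R.1 θ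
      · right
        ext y
        simp [hθ]
      · left
        simp [hθ]

theorem mem_dcl_image_fst {A : Set (M × N)} {p : M × N}
    (hp : p ∈ dcl (relLang (unionSymb SM SN)) A) : p.1 ∈ dcl (relLang SM) (Prod.fst '' A) := by
  have := isDefinableCover_prodMk_left.definable₁_preimage (B := Prod.fst '' A)
    (fun q hq => ⟨q.2, .inl ⟨q.1, mem_image_of_mem _ hq, rfl⟩⟩) hp p.2
  have preimage_eq : (fun a => (a, p.2)) ⁻¹' {p} = {p.1} := by
    ext a
    simp [Prod.ext_iff]
  rwa [preimage_eq] at this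

/-- The maps onto `M × N` which either identify `N` with the fibre over `a`, or are constant with
a value outside this fibre. -/
def fiberCover (a : M) : Option {p : M × N // p.1 ≠ a} → N → M × N
  | none, b => (a, b)
  | some p, _ => p

theorem fst_fiberCover_eq (a : M) (θ : Option {p : M × N // p.1 ≠ a}) (b b' : N) :
    (fiberCover a θ b).1 = (fiberCover a θ b').1 := by
  cases θ <;> rfl

theorem fiberCover_eq_of_fst_ne {a : M} {θ : Option {p : M × N // p.1 ≠ a}} {b : N}
    (h : (fiberCover a θ b).1 ≠ a) (b' : N) : fiberCover a θ b' = fiberCover a θ b := by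
  cases θ with
  | none => exact absurd rfl h
  | some p => rfl

theorem relMap_fiberCover_none (a : M) {n : ℕ}
    (R : (relLang (unionSymb SM SN)).Relations n) (y : Fin n → N) :
    Structure.RelMap R (fun i => fiberCover a none (y i)) ↔
      rel SM R.1 (fun _ => a) ∨ rel SN R.1 y := by
  simp [relMap_iff_rel, rel_unionSymb_iff, fiberCover]

theorem relMap_fiberCover_of_some {a : M} {n : ℕ}
    (R : (relLang (unionSymb SM SN)).Relations n) {θ : Fin n → Option {p : M × N // p.1 ≠ a}}
    {j : Fin n} {p : {p : M × N // p.1 ≠ a}} (hj : θ j = some p) {y : Fin n → N}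
    (hy : Structure.RelMap R fun i => fiberCover a (θ i) (y i)) (y' : Fin n → N) :
    Structure.RelMap R fun i => fiberCover a (θ i) (y' i) := by
  by_cases hconst : ∀ i j, (fiberCover a (θ i) (y i)).1 = (fiberCover a (θ j) (y j)).1
  · have eq (i : Fin n) : fiberCover a (θ i) (y' i) = fiberCover a (θ i) (y i) := by
      refine fiberCover_eq_of_fst_ne (fun h => p.2 ?_) _
      calc p.1.1 = (fiberCover a (θ j) (y j)).1 := by rw [hj]; rfl
        _ = (fiberCover a (θ i) (y i)).1 := hconst j i
        _ = a := h
    simpa only [eq] using hy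
  · have fst_eq : (fun i => (fiberCover a (θ i) (y i)).1) =
        fun i => (fiberCover a (θ i) (y' i)).1 :=
      funext fun i => fst_fiberCover_eq a (θ i) (y i) (y' i)
    rw [relMap_iff_rel, rel_unionSymb_iff] at hy ⊢
    exact .inl (fst_eq ▸ hy.resolve_right fun h => hconst h.1)

theorem isDefinableCover_fiberCover (a : M) :
    IsDefinableCover (relLang (unionSymb SM SN)) (relLang SN) (fiberCover (N := N) a) where
  exists_eq := fun x => by
    by_cases hx : x.1 = a
    · exact ⟨none, x.2, Prod.ext hx.symm rfl⟩
    · exact ⟨some ⟨x, hx⟩, x.2, rfl⟩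
  finitelyDefinable_eq := by
    refine .of_forall_mem (G := {{y | y 0 = y 1}, ∅, univ}) (toFinite _) ?_ fun θ => ?_
    · rintro _ (rfl | rfl | rfl)
      exacts [Definable.diagonal _ _, definable_empty, definable_univ]
    · rcases θ 0 with _ | p <;> rcases θ 1 with _ | q
      · simp [fiberCover]
      · have : ∀ b, (a, b) ≠ q.1 := fun b h => q.2 (congrArg Prod.fst h).symm
        simp [fiberCover, this]
      · have : ∀ b, p.1 ≠ (a, b) := fun b h => p.2 (congrArg Prod.fst h)
        simp [fiberCover, this]
      · by_cases hpq : p.1 = q.1 <;> simp [fiberCover, hpq]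
  finitelyDefinable_relMap := fun {n} R => by
    refine .of_forall_mem (G := {{y | rel SN R.1 y}, ∅, univ}) (toFinite _) ?_ fun θ => ?_
    · rintro _ (rfl | rfl | rfl)
      exacts [definable_rel _, definable_empty, definable_univ]
    · by_cases hsome : ∃ j p, θ j = some p
      · obtain ⟨j, p, hj⟩ := hsome
        rcases eq_empty_or_nonempty {y : Fin n → N |
            Structure.RelMap R fun i => fiberCover a (θ i) (y i)} with hempty | ⟨y, hy⟩
        · exact .inr (.inl hempty)
        · exact .inr (.inr (eq_univ_of_forall (relMap_fiberCover_of_some R hj hy)))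
      · have θ_eq (i : Fin n) : θ i = none :=
          Option.eq_none_iff_forall_ne_some.2 fun p hp => hsome ⟨i, p, hp⟩
        by_cases ha : rel SM R.1 fun _ : Fin n => a <;>
          simp [θ_eq, relMap_fiberCover_none, ha]

theorem mem_dcl_fiber {A : Set (M × N)} {a : M} {b : N}
    (hp : (a, b) ∈ dcl (relLang (unionSymb SM SN)) A) :
    b ∈ dcl (relLang SN) (Prod.mk a ⁻¹' A) := by
  have parameter : ∀ p ∈ A, ∃ θ, p ∈ fiberCover a θ '' (Prod.mk a ⁻¹' A) ∨
      ∀ y, fiberCover a θ y = p := by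
    rintro ⟨a', b'⟩ hA
    by_cases ha : a' = a
    · subst ha
      exact ⟨none, .inl ⟨b', hA, rfl⟩⟩
    · exact ⟨some ⟨(a', b'), ha⟩, .inr fun _ => rfl⟩
  have := (isDefinableCover_fiberCover a).definable₁_preimage parameter hp none
  have preimage_eq : fiberCover a none ⁻¹' {(a, b)} = {b} := by
    ext b'
    simp [fiberCover]
  rwa [preimage_eq] at this

theorem IsEDefinableComposition.definable_fst_eq (hE : IsEDefinableComposition SM SN M N) :
    (∅ : Set (M × N)).Definable₂ (relLang (unionSymb SM SN)) {p | p.1.1 = p.2.1} := by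
  obtain ⟨⟨E, hdef, hclasses⟩, -⟩ := hE
  have rel_iff (p q : M × N) : E p q ↔ p.1 = q.1 := by
    obtain ⟨a, ha⟩ : {x | E x q} ∈ range fun a : M => {p : M × N | p.1 = a} := hclasses ▸ ⟨q, rfl⟩
    have mem_class (x : M × N) : x.1 = a ↔ E x q := Set.ext_iff.1 ha x
    rw [← mem_class, (mem_class q).2 (E.refl q)]
  simpa only [rel_iff] using hdef

theorem SharedSymbolsDiagonal.definable_rel_fst [Nonempty M] {A : Set (M × N)}
    (hdiag : SharedSymbolsDiagonal SM SN M) (hE : IsEDefinableComposition SM SN M N)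
    {n : ℕ} {R : S n} (hR : R ∈ SM n) :
    A.Definable (relLang (unionSymb SM SN)) {x : Fin n → M × N | rel SM R (Prod.fst ∘ x)} := by
  have definable_union : A.Definable (relLang (unionSymb SM SN))
      {x : Fin n → M × N | rel (unionSymb SM SN) R x} := definable_rel R
  have definable_const : A.Definable (relLang (unionSymb SM SN))
      {x : Fin n → M × N | ∀ i j, (x i).1 = (x j).1} :=
    definable_forall_rel (hE.definable_fst_eq.mono (empty_subset A))
  by_cases hRN : R ∈ SN n
  · rcases hdiag n R hR hRN with hall | hnone
    · convert definable_union.union definable_const using 1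
      ext x
      have rel_of_const (h : ∀ i j, (x i).1 = (x j).1) : rel SM R (Prod.fst ∘ x) := by
        obtain ⟨a, ha⟩ := exists_eq_const h
        exact (congrArg (rel SM R) ha).mpr (hall a)
      simp only [mem_ofPred_eq, mem_union, rel_unionSymb_iff]
      tauto
    · convert definable_union.sdiff definable_const using 1
      ext x
      have not_const_of_rel (h : rel SM R (Prod.fst ∘ x)) : ¬ ∀ i j, (x i).1 = (x j).1 := by
        intro hconst
        obtain ⟨a, ha⟩ := exists_eq_const hconst
        exact hnone a ((congrArg (rel SM R) ha).mp h)
      simp only [mem_ofPred_eq, mem_sdiff, rel_unionSymb_iff]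
      tauto
  · have not_rel (y : Fin n → N) : ¬ rel SN R y := fun h => hRN h.1
    simpa only [rel_unionSymb_iff, not_rel, and_false, or_false] using! definable_union

theorem isInterpretation_fst [Nonempty M] [Nonempty N] (hE : IsEDefinableComposition SM SN M N)
    (hdiag : SharedSymbolsDiagonal SM SN M) (A : Set (M × N)) :
    IsInterpretation (relLang (unionSymb SM SN)) (relLang SM) A univ (Prod.fst : M × N → M) where
  definable_domain := definable_univ
  surjOn := surjOn_univ.2 Prod.fst_surjective
  definableOn_eq := .of_definable (hE.definable_fst_eq.mono (empty_subset A))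
  definableOn_relMap R := by
    simpa only [relMap_iff_rel] using! DefinableOn.of_definable (hdiag.definable_rel_fst hE R.2)

theorem isInterpretation_snd (hE : IsEDefinableComposition SM SN M N) {A : Set (M × N)} {a : M}
    (ha : A.Definable₁ (relLang (unionSymb SM SN)) {p | p.1 = a}) :
    IsInterpretation (relLang (unionSymb SM SN)) (relLang SN) A {p | p.1 = a} Prod.snd where
  definable_domain := ha
  surjOn b _ := ⟨(a, b), rfl, rfl⟩
  definableOn_eq := ⟨_, Definable.diagonal _ A, fun x hx =>
    ⟨congrArg Prod.snd, Prod.ext ((hx 0).trans (hx 1).symm)⟩⟩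
  definableOn_relMap R := by
    refine ⟨_, definable_rel R.1, fun x hx => ?_⟩
    have x_eq : x = fun i => (a, (x i).2) := funext fun i => Prod.ext (hx i) rfl
    rw [mem_ofPred_eq, mem_ofPred_eq, relMap_iff_rel, x_eq]
    exact hE.2 a _ R.1 R.2 _

theorem mk_mem_dcl (hE : IsEDefinableComposition SM SN M N) {A : Set (M × N)} {a : M} {b : N}
    (ha : A.Definable₁ (relLang (unionSymb SM SN)) {p | p.1 = a})
    (hb : b ∈ dcl (relLang SN) (Prod.mk a ⁻¹' A)) :
    (a, b) ∈ dcl (relLang (unionSymb SM SN)) A := by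
  have := (isInterpretation_snd hE ha).definable₁_inter_preimage
    (fun c hc => ⟨(a, c), ⟨hc, rfl⟩, rfl⟩) hb
  have inter_eq : {p : M × N | p.1 = a} ∩ Prod.snd ⁻¹' {b} = {(a, b)} :=
    Set.ext fun _ => (Prod.ext_iff (y := (a, b))).symm
  rwa [inter_eq] at this

theorem syntRigidOver_prod_singleton [Nonempty M] [Nonempty N]
    (hE : IsEDefinableComposition SM SN M N) (hdiag : SharedSymbolsDiagonal SM SN M)
    (hN : SyntRigidOver (relLang SN) (∅ : Set N)) {A : Set M} (hA : SyntRigidOver (relLang SM) A)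
    (c : N) : SyntRigidOver (relLang (unionSymb SM SN)) (A ×ˢ {c}) := by
  refine eq_univ_of_forall fun ⟨a, b⟩ => mk_mem_dcl hE ?_ ((hN.mem_dcl b).mono (empty_subset _))
  have := (isInterpretation_fst hE hdiag (A ×ˢ {c})).definable₁_inter_preimage
    (fun a ha => ⟨(a, c), ⟨⟨ha, rfl⟩, mem_univ _⟩, rfl⟩) (hA.mem_dcl a)
  rwa [univ_inter] at this

theorem syntRigidOver_univ_prod (hE : IsEDefinableComposition SM SN M N) {A : Set N}
    (hne : A.Nonempty) (hA : SyntRigidOver (relLang SN) A) :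
    SyntRigidOver (relLang (unionSymb SM SN)) ((univ : Set M) ×ˢ A) := by
  obtain ⟨c, hc⟩ := hne
  refine eq_univ_of_forall fun ⟨a, b⟩ => mk_mem_dcl hE ?_ ?_
  · exact definable₁_section (hE.definable_fst_eq.mono (empty_subset _)) (c := (a, c))
      ⟨mem_univ a, hc⟩
  · rw [mk_preimage_prod_right (mem_univ a)]
    exact hA.mem_dcl b

theorem SyntRigidOver.image_fst [Nonempty N] {A : Set (M × N)}
    (hA : SyntRigidOver (relLang (unionSymb SM SN)) A) :
    SyntRigidOver (relLang SM) (Prod.fst '' A) :=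
  eq_univ_of_forall fun a => mem_dcl_image_fst (hA.mem_dcl (a, Classical.arbitrary N))

theorem SyntRigidOver.preimage_mk {A : Set (M × N)}
    (hA : SyntRigidOver (relLang (unionSymb SM SN)) A) (a : M) :
    SyntRigidOver (relLang SN) (Prod.mk a ⁻¹' A) :=
  eq_univ_of_forall fun b => mem_dcl_fiber (hA.mem_dcl (a, b))

theorem degExistsSynt_comp_of_syntRigidOver_empty [Nonempty M] [Nonempty N]
    (hE : IsEDefinableComposition SM SN M N) (hdiag : SharedSymbolsDiagonal SM SN M)
    (hN : SyntRigidOver (relLang SN) (∅ : Set N)) :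
    degExistsSynt (relLang (unionSymb SM SN)) (M × N) = degExistsSynt (relLang SM) M := by
  refine le_antisymm (le_degExistsSynt fun A hA => ?_) (le_degExistsSynt fun A hA => ?_)
  · calc degExistsSynt (relLang (unionSymb SM SN)) (M × N)
        ≤ (A ×ˢ {Classical.arbitrary N}).encard :=
          degExistsSynt_le_encard (syntRigidOver_prod_singleton hE hdiag hN hA _)
      _ = A.encard := by rw [encard_prod, encard_singleton, mul_one]
  · exact (degExistsSynt_le_encard hA.image_fst).trans (encard_image_le _ _)

theorem degExistsSynt_comp_of_not_syntRigidOver_empty [Nonempty M]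
    (hE : IsEDefinableComposition SM SN M N) (hN : ¬ SyntRigidOver (relLang SN) (∅ : Set N)) :
    degExistsSynt (relLang (unionSymb SM SN)) (M × N) =
      ENat.card M * degExistsSynt (relLang SN) N := by
  refine le_antisymm ?_ (le_degExistsSynt fun A hA =>
    card_mul_le_encard fun a => degExistsSynt_le_encard (hA.preimage_mk a))
  by_cases htop : degExistsSynt (relLang SN) N = ⊤
  · rw [htop, ENat.mul_top (by simp)]
    exact le_top
  · obtain ⟨A, hcard, hA⟩ := exists_encard_eq_degExistsSynt htop
    have hne : A.Nonempty := nonempty_iff_ne_empty.2 fun hempty => hN (hempty ▸ hA)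
    calc degExistsSynt (relLang (unionSymb SM SN)) (M × N)
        ≤ ((univ : Set M) ×ˢ A).encard :=
          degExistsSynt_le_encard (syntRigidOver_univ_prod hE hne hA)
      _ = ENat.card M * degExistsSynt (relLang SN) N := by rw [encard_prod, encard_univ, hcard]

end Composition

end Rigidity

theorem mainTheorem7 {S : ℕ → Type u} (SM SN : ∀ n, Set (S n))
    (M : Type v) (N : Type w) [Nonempty M] [Nonempty N]
    [(Rigidity.relLang SM).Structure M] [(Rigidity.relLang SN).Structure N]
    (hE : Rigidity.IsEDefinableComposition SM SN M N) :
    (Rigidity.dcl (Rigidity.relLang SN) (∅ : Set N) = Set.univ →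
      Rigidity.SharedSymbolsDiagonal SM SN M →
        Rigidity.degExistsSynt (Rigidity.relLang (Rigidity.unionSymb SM SN)) (M × N) =
            Rigidity.degExistsSynt (Rigidity.relLang SM) M ∧
        (Rigidity.degExistsSynt (Rigidity.relLang (Rigidity.unionSymb SM SN)) (M × N) ≠ ⊤ ↔
          Rigidity.degExistsSynt (Rigidity.relLang SM) M ≠ ⊤)) ∧
    (Rigidity.dcl (Rigidity.relLang SN) (∅ : Set N) ≠ Set.univ →
        Rigidity.degExistsSynt (Rigidity.relLang (Rigidity.unionSymb SM SN)) (M × N) =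
            ENat.card M * Rigidity.degExistsSynt (Rigidity.relLang SN) N ∧
        (Rigidity.degExistsSynt (Rigidity.relLang (Rigidity.unionSymb SM SN)) (M × N) ≠ ⊤ ↔
          Rigidity.degExistsSynt (Rigidity.relLang SN) N ≠ ⊤ ∧ Finite M)) := by
  refine ⟨fun hN hdiag => ?_, fun hN => ?_⟩
  · rw [Rigidity.degExistsSynt_comp_of_syntRigidOver_empty hE hdiag hN]
    exact ⟨rfl, Iff.rfl⟩
  · rw [Rigidity.degExistsSynt_comp_of_not_syntRigidOver_empty hE hN]
    have deg_ne_zero := Rigidity.degExistsSynt_ne_zero hN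
    have card_ne_zero : ENat.card M ≠ 0 := by simp
    refine ⟨rfl, fun h => ⟨fun deg_eq_top => h ?_, ?_⟩, fun ⟨hdeg, hM⟩ => ?_⟩
    · rw [deg_eq_top, ENat.mul_top card_ne_zero]
    · by_contra hM
      rw [not_finite_iff_infinite] at hM
      exact h (by rw [ENat.card_eq_top_of_infinite, ENat.top_mul deg_ne_zero])
    · exact WithTop.mul_ne_top (ENat.card_lt_top.2 hM).ne hdeg
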